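/- **Problem.** For $n\ge 1$, in the two-curve intersection problem $\mathrm{TCI}_n$ Alice holds a sequence $a=(a_1,\dots,a_n)\in\mathbb{Q}^n$ and Bob holds a sequence $b=(b_1,\dots,b_n)\in\mathbb{Q}^n$. The sequence $a$ is strictly increasing and convex ($a_i-a_{i-1}\le a_{i+1}-a_i$ for $1<i<n$), the sequence $b$ is strictly decreasing and concave ($b_i-b_{i-1}\ge b_{i+1}-b_i$ for $1<i<n$), and it is promised that there is an index $i\in\{1,\dots,n-1\}$ with $a_i\le b_i$ and $a_{i+1}>b_{i+1}$. The goal is to find the smallest such index. For $s\in\mathbb{N}$ let $\mathrm{TCI}_{n,s}$ be the same problem restricted to inputs in which all numerators and denominators (in lowest terms) have at most $s$ bits. **Model.** In an $r$-round randomized protocol the two players share a random string and exchange $r$ messages, which are possibly empty bit strings. The players alternate, and Alice sends the last message (so Alice starts if $r$ is odd and Bob starts if $r$ is even). Each message depends only on the sender's input, the random string and the previous messages, and after the last message Bob outputs the answer. The protocol solves a problem if on every valid input the output is correct with probability at least $2/3$. Its cost is the maximum, over all valid inputs and all random strings, of the total number of bits sent. The $r$-round randomized communication complexity $\mathrm{CC}^{r}(P)\in\mathbb{N}\cup\{\infty\}$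 is the minimum cost of an $r$-round randomized protocol that solves $P$. **Theorem.** $\mathrm{CC}^{r}(\mathrm{TCI}_n)=\Omega(n^{1/r}/r^2)$ for all $r\ge1$, with an absolute constant, and this holds already for numbers with polynomially many bits. That is, there are an absolute real constant $c>0$ and an absolute $K\in\mathbb{N}$ such that for all integers $r\ge 1$ and $n\ge 3$ $$\mathrm{CC}^{r}(\mathrm{TCI}_n)\ \ge\ c\cdot\frac{n^{1/r}}{r^2}\qquad\text{and}\qquad \mathrm{CC}^{r}(\mathrm{TCI}_{n,\,n^K})\ \ge\ c\cdot\frac{n^{1/r}}{r^2}.$$ -/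

import Mathlib

open scoped ENNReal
open MeasureTheory

/-- A two-party communication problem with a promise: Alice gets `x : X`, Bob gets `y : Y`,
the pair satisfies `valid x y`, and Bob has to produce some `z : Z` with `correct x y z`. -/
structure CommProblem (X Y Z : Type) where
  valid : X → Y → Prop
  correct : X → Y → Z → Prop

/-- A deterministic protocol. The next message (a bit string) of a player is a function of the
player's own input and of all the messages exchanged so far. Bob produces the output from his own
input and the complete transcript. The number of rounds is a parameter of `transcript`. -/
structure DetProtocol (X Y Z : Type) where
  aliceMsg : X → List (List Bool) → List Bool
  bobMsg : Y → List (List Bool) → List Bool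
  output : Y → List (List Bool) → Z

namespace DetProtocol

variable {X Y Z : Type}

/-- The first `t` messages of an `r`-round run. The players alternate, and Alice sends the `r`-th
(last) message. So Alice starts when `r` is odd and Bob starts when `r` is even. The message that
follows `t` earlier ones is sent by Alice exactly when `r + t` is odd. An empty message is allowed
and costs nothing, so protocols with fewer than `r` rounds are included. -/
def transcript (π : DetProtocol X Y Z) (r : ℕ) (x : X) (y : Y) : ℕ → List (List Bool)
  | 0 => []
  | t + 1 =>
    let h := transcript π r x y t
    h ++ [if Odd (r + t) then π.aliceMsg x h else π.bobMsg y h]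

/-- The answer that Bob gives after `r` rounds. -/
def result (π : DetProtocol X Y Z) (r : ℕ) (x : X) (y : Y) : Z :=
  π.output y (π.transcript r x y r)

/-- The total number of bits sent by both players in `r` rounds. -/
def cost (π : DetProtocol X Y Z) (r : ℕ) (x : X) (y : Y) : ℕ :=
  ((π.transcript r x y r).map List.length).sum

end DetProtocol

/-- A randomized protocol is a family of deterministic protocols indexed by the points of a
probability space, the shared random string. (Private coins are the special case where the space
is a product and each player looks only at one factor.) It solves `P` in `r` rounds if on every
valid input the answer is correct with probability at least `2/3`. -/
def SolvesInRounds {X Y Z Ω : Type} [MeasurableSpace Ω] (μ : Measure Ω)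
    (π : Ω → DetProtocol X Y Z) (r : ℕ) (P : CommProblem X Y Z) : Prop :=
  ∀ x y, P.valid x y →
    MeasurableSet {ω | P.correct x y ((π ω).result r x y)} ∧
    2 / 3 ≤ μ {ω | P.correct x y ((π ω).result r x y)}

/-- The `r`-round randomized communication complexity of `P`: the least worst-case cost (over all
valid inputs and all outcomes of the random string) of a randomized protocol that solves `P` in
`r` rounds; it is `⊤` if there is no such protocol of bounded cost. -/
noncomputable def roundCC {X Y Z : Type} (r : ℕ) (P : CommProblem X Y Z) : ℕ∞ :=
  sInf {k : ℕ∞ | ∃ (Ω : Type) (_ : MeasurableSpace Ω) (μ : Measure Ω)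
    (π : Ω → DetProtocol X Y Z), IsProbabilityMeasure μ ∧ SolvesInRounds μ π r P ∧
      ∀ ω x y, P.valid x y → ((π ω).cost r x y : ℕ∞) ≤ k}

/-- Successive differences do not decrease. -/
def ConvexSeq {n : ℕ} (a : Fin n → ℚ) : Prop :=
  ∀ (i : ℕ) (h : i + 2 < n),
    a ⟨i + 1, by omega⟩ - a ⟨i, by omega⟩ ≤ a ⟨i + 2, h⟩ - a ⟨i + 1, by omega⟩

/-- Successive differences do not increase. -/
def ConcaveSeq {n : ℕ} (b : Fin n → ℚ) : Prop :=
  ∀ (i : ℕ) (h : i + 2 < n),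
    b ⟨i + 2, h⟩ - b ⟨i + 1, by omega⟩ ≤ b ⟨i + 1, by omega⟩ - b ⟨i, by omega⟩

/-- The indices `i` with `a i ≤ b i` and `a (i + 1) > b (i + 1)`; both indices must exist. -/
def crossings {n : ℕ} (a b : Fin n → ℚ) : Set (Fin n) :=
  {i | a i ≤ b i ∧ ∃ h : (i : ℕ) + 1 < n, b ⟨i + 1, h⟩ < a ⟨i + 1, h⟩}

/-- The two-curve intersection problem for sequences of length `n`. -/
def TCI (n : ℕ) : CommProblem (Fin n → ℚ) (Fin n → ℚ) (Fin n) where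
  valid a b := StrictMono a ∧ ConvexSeq a ∧ StrictAnti b ∧ ConcaveSeq b ∧ (crossings a b).Nonempty
  correct a b i := IsLeast (crossings a b) i

/-- The two-curve intersection problem restricted to sequences in which all numerators and
denominators have at most `s` bits. -/
def TCIBits (n s : ℕ) : CommProblem (Fin n → ℚ) (Fin n → ℚ) (Fin n) where
  valid a b := (TCI n).valid a b ∧
    ∀ i, (a i).num.natAbs < 2 ^ s ∧ (a i).den < 2 ^ s ∧
      (b i).num.natAbs < 2 ^ s ∧ (b i).den < 2 ^ s
  correct := (TCI n).correct

/-!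
The proof is by round elimination for a recursively defined game, which is then drawn as a pair of
convex curves.

*The game.* `nestedGame k 0` asks to guess a random bit that the opponent holds. In
`nestedGame k (r + 1)` the first speaker holds `k` independent inputs of the *other* player of
`nestedGame k r`; the other player holds an index `i`, the entries after position `i`, and an
input of the first speaker of `nestedGame k r` that goes with entry `i`. They have to play
`nestedGame k r` at entry `i`, so the roles are exchanged in each level.

*Round elimination.* The first message is chosen without knowledge of `i`. Fix a message `m`. For
every `i` and all later entries, let `f m i` be the indicator of success at entry `i` when the
speaker replaces the full input by the best one that has these later entries, the given entry `i`
and the first message `m`. This is at least the true success indicator, and its mean over entry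
`i` is the success probability of a protocol for the smaller game without the first message. The
differences from these means form a martingale difference sequence when the entries are exposed
from the last to the first. The moment bound `sum_exp_sum_le` and a union bound over the messages
(`sum_selected_le`) show that the sum over `i` of the differences, taken at the message that is
sent, is at most `log |M| / c + c k / 2` on average, for every `c > 0`. Hence a round gains at most
`log |M| / (c k) + c / 2` (`Game.score_comp_le`), and with `r` rounds the success probability is at
most `1 / 2 + r (log |M| / (c k) + c / 2)`. With `c = 1 / (6 r)` and messages of at most `C` bits,
success probability `2 / 3` forces `k ≤ 72 r ^ 2 (C + 1)`. This is where the factor `r ^ 2` comes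
from.

*The curves.* Writing Bob's sequence as `-g`, an instance is a pair of increasing convex curves
`f`, `g`, and one looks for the place where `f + g` becomes positive; this is symmetric in the
players. In `realization_comp` the first speaker concatenates the `k` curves of the entries, with
entry `j` scaled by `R ^ j`, where `R` bounds all increments: this makes the result convex. The
other player follows the scaled curve of the subgame in block `i`, with a small constant slope
before and a large one after it. To place this curve at the right height one has to know the
height of the first speaker's curve at the end of block `i`. It is determined by the later entries,
because all the curves of a listener end at height zero; a last large increment restores this
property for the next level. So the length grows by a factor `k` and the logarithm of the slopes
by a factor `k + 2` per level, and `k` of order `n ^ (1 / r)` and numbers with `n ^ 3` bits suffice.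
-/

/-! ### A maximal inequality for sums of martingale differences -/

theorem sum_exp_le_of_abs_le_one {Ω : Type*} [Fintype Ω] (g : Ω → ℝ) (hb : ∀ v, |g v| ≤ 1)
    (hmean : ∑ v, g v = 0) (c : ℝ) :
    ∑ v, Real.exp (c * g v) ≤ Fintype.card Ω * Real.exp (c ^ 2 / 2) := by
  -- On `[-1, 1]` the convex function `exp (c * ·)` lies below its chord.
  have chord : ∀ v, Real.exp (c * g v) ≤ Real.cosh c + g v * Real.sinh c := by
    intro v
    obtain ⟨h1, h2⟩ := abs_le.mp (hb v)
    have h := convexOn_exp.2 (Set.mem_univ c) (Set.mem_univ (-c))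
      (show 0 ≤ (1 + g v) / 2 by linarith) (show 0 ≤ (1 - g v) / 2 by linarith) (by ring)
    simp only [smul_eq_mul] at h
    rw [Real.cosh_eq, Real.sinh_eq]
    calc Real.exp (c * g v)
        = Real.exp ((1 + g v) / 2 * c + (1 - g v) / 2 * -c) := by congr 1; ring
      _ ≤ _ := h
      _ = _ := by ring
  calc ∑ v, Real.exp (c * g v) ≤ ∑ v, (Real.cosh c + g v * Real.sinh c) :=
        Finset.sum_le_sum fun v _ => chord v
    _ = Fintype.card Ω * Real.cosh c := by
        rw [Finset.sum_add_distrib, ← Finset.sum_mul, hmean]; simp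
    _ ≤ _ := by gcongr; exact Real.cosh_le_exp_half_sq c

theorem sum_pi_fin_succ {Ω : Type*} [Fintype Ω] {k : ℕ} (F : (Fin (k + 1) → Ω) → ℝ) :
    ∑ ω, F ω = ∑ ω : Fin k → Ω, ∑ v, F (Fin.cons v ω) := by
  rw [← (Fin.consEquiv (fun _ => Ω)).sum_comp, Fintype.sum_prod_type, Finset.sum_comm]
  rfl

/-- The Azuma–Hoeffding moment bound for uniform product measure, with the coordinates exposed
from the last to the first: the `i`-th increment depends on the coordinates `≥ i` and has mean
zero in coordinate `i`. -/
theorem sum_exp_sum_le {Ω : Type*} [Fintype Ω] [Nonempty Ω] (c : ℝ) (k : ℕ)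
    (g : Fin k → (Fin k → Ω) → ℝ) (hb : ∀ i ω, |g i ω| ≤ 1)
    (hdep : ∀ i ω ω', (∀ j, i ≤ j → ω j = ω' j) → g i ω = g i ω')
    (hmean : ∀ i ω, ∑ v, g i (Function.update ω i v) = 0) :
    ∑ ω, Real.exp (c * ∑ i, g i ω) ≤ Fintype.card (Fin k → Ω) * Real.exp (k * (c ^ 2 / 2)) := by
  induction k with
  | zero => simp
  | succ k ih =>
    obtain ⟨v₀⟩ := ‹Nonempty Ω›
    let g' : Fin k → (Fin k → Ω) → ℝ := fun i ω => g i.succ (Fin.cons v₀ ω)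
    have hg' : ∀ i ω v, g i.succ (Fin.cons v ω) = g' i ω := by
      intro i ω v
      apply hdep
      intro j hj
      obtain ⟨j, rfl⟩ := Fin.exists_succ_eq.mpr (Fin.ne_of_gt ((Fin.succ_pos i).trans_le hj))
      simp
    have key := ih g' (fun i ω => hb _ _)
      (by
        intro i ω ω' h
        apply hdep
        intro j hj
        obtain ⟨j, rfl⟩ := Fin.exists_succ_eq.mpr (Fin.ne_of_gt ((Fin.succ_pos i).trans_le hj))
        simpa using h j (by simpa using hj))
      (by
        intro i ω
        have := hmean i.succ (Fin.cons v₀ ω)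
        simpa only [g', Fin.cons_update] using this)
    rw [sum_pi_fin_succ]
    calc ∑ ω : Fin k → Ω, ∑ v, Real.exp (c * ∑ i, g i (Fin.cons v ω))
        = ∑ ω : Fin k → Ω, Real.exp (c * ∑ i, g' i ω) *
            ∑ v, Real.exp (c * g 0 (Fin.cons v ω)) := by
          refine Finset.sum_congr rfl fun ω _ => ?_
          rw [Finset.mul_sum]
          refine Finset.sum_congr rfl fun v _ => ?_
          rw [Fin.sum_univ_succ, ← Real.exp_add]
          simp only [hg']
          congr 1; ring
      _ ≤ ∑ ω : Fin k → Ω, Real.exp (c * ∑ i, g' i ω) *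
            (Fintype.card Ω * Real.exp (c ^ 2 / 2)) := by
          refine Finset.sum_le_sum fun ω _ => ?_
          gcongr
          apply sum_exp_le_of_abs_le_one _ (fun v => hb _ _)
          simpa using hmean 0 (Fin.cons v₀ ω)
      _ ≤ (Fintype.card (Fin k → Ω) * Real.exp (k * (c ^ 2 / 2))) *
            (Fintype.card Ω * Real.exp (c ^ 2 / 2)) := by
          rw [← Finset.sum_mul]
          gcongr
      _ = _ := by
          have : Real.exp (((k + 1 : ℕ) : ℝ) * (c ^ 2 / 2))
              = Real.exp (k * (c ^ 2 / 2)) * Real.exp (c ^ 2 / 2) := by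
            rw [← Real.exp_add]; congr 1; push_cast; ring
          rw [this]
          simp only [Fintype.card_fun, Fintype.card_fin, pow_succ]
          push_cast
          ring

/-- A message `m ω` with few possible values has little correlation with a martingale difference
sequence, even one that is chosen in the light of the message. -/
theorem sum_selected_le {Ω M : Type*} [Fintype Ω] [Nonempty Ω] [Fintype M] [Nonempty M] (k : ℕ)
    (g : M → Fin k → (Fin k → Ω) → ℝ) (hb : ∀ m i ω, |g m i ω| ≤ 1)
    (hdep : ∀ m i ω ω', (∀ j, i ≤ j → ω j = ω' j) → g m i ω = g m i ω')
    (hmean : ∀ m i ω, ∑ v, g m i (Function.update ω i v) = 0)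
    (m : (Fin k → Ω) → M) {c : ℝ} (hc : 0 < c) :
    ∑ ω, ∑ i, g (m ω) i ω ≤
      Fintype.card (Fin k → Ω) * (Real.log (Fintype.card M) / c + k * (c / 2)) := by
  set a : ℝ := Real.log (Fintype.card M) + k * (c ^ 2 / 2) with ha
  have hM : (0 : ℝ) < Fintype.card M := by exact_mod_cast Fintype.card_pos
  have h1 : ∑ ω, Real.exp (c * ∑ i, g (m ω) i ω) ≤ Fintype.card (Fin k → Ω) * Real.exp a := by
    calc ∑ ω, Real.exp (c * ∑ i, g (m ω) i ω)
        ≤ ∑ ω, ∑ m', Real.exp (c * ∑ i, g m' i ω) :=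
          Finset.sum_le_sum fun ω _ => Finset.single_le_sum
            (f := fun m' => Real.exp (c * ∑ i, g m' i ω))
            (fun _ _ => (Real.exp_pos _).le) (Finset.mem_univ (m ω))
      _ = ∑ m', ∑ ω, Real.exp (c * ∑ i, g m' i ω) := Finset.sum_comm
      _ ≤ ∑ _m' : M, Fintype.card (Fin k → Ω) * Real.exp (k * (c ^ 2 / 2)) :=
          Finset.sum_le_sum fun m' _ => sum_exp_sum_le c k _ (hb m') (hdep m') (hmean m')
      _ = _ := by
          rw [ha, Real.exp_add, Real.exp_log hM]
          simp only [Finset.sum_const, Finset.card_univ, nsmul_eq_mul]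
          ring
  -- Jensen's inequality, in the form `x ≤ exp (x - a) + a - 1`.
  have h2 : ∑ ω, c * ∑ i, g (m ω) i ω ≤ Fintype.card (Fin k → Ω) * a := by
    calc ∑ ω, c * ∑ i, g (m ω) i ω
        ≤ ∑ ω, (Real.exp (c * ∑ i, g (m ω) i ω) * Real.exp (-a) + (a - 1)) := by
          refine Finset.sum_le_sum fun ω _ => ?_
          rw [← Real.exp_add]
          have := Real.add_one_le_exp (c * ∑ i, g (m ω) i ω + -a)
          linarith
      _ = (∑ ω, Real.exp (c * ∑ i, g (m ω) i ω)) * Real.exp (-a)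
            + Fintype.card (Fin k → Ω) * (a - 1) := by
          rw [Finset.sum_add_distrib, Finset.sum_mul, Finset.sum_const, Finset.card_univ,
            nsmul_eq_mul]
      _ ≤ (Fintype.card (Fin k → Ω) * Real.exp a) * Real.exp (-a)
            + Fintype.card (Fin k → Ω) * (a - 1) := by gcongr
      _ = _ := by
          rw [mul_assoc, ← Real.exp_add, add_neg_cancel, Real.exp_zero]; ring
  rw [← Finset.mul_sum] at h2
  have h3 : Fintype.card (Fin k → Ω) * (Real.log (Fintype.card M) / c + k * (c / 2))
      = Fintype.card (Fin k → Ω) * a / c := by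
    rw [ha]; field_simp
  rw [h3, le_div_iff₀ hc]
  linarith

theorem sum_sum_update {Ω : Type*} [Fintype Ω] {k : ℕ} (i : Fin k) (F : (Fin k → Ω) → ℝ) :
    ∑ ω, ∑ v, F (Function.update ω i v) = Fintype.card Ω * ∑ ω, F ω := by
  classical
  have swap : ∑ p : (Fin k → Ω) × Ω, F (Function.update p.1 i p.2)
      = ∑ p : (Fin k → Ω) × Ω, F p.1 := by
    refine Finset.sum_bij' (fun p _ => (Function.update p.1 i p.2, p.1 i))
      (fun p _ => (Function.update p.1 i p.2, p.1 i)) ?_ ?_ ?_ ?_ ?_ <;> simp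
  rw [Fintype.sum_prod_type, Fintype.sum_prod_type] at swap
  rw [swap, Finset.mul_sum]
  simp

/-! ### Games with alternating messages -/

/-- How a player with inputs in `X` behaves: the next message (from a set `M`) and the final
answer, both as functions of the input and of the earlier messages. -/
structure Player (X M : Type) where
  msg : X → List M → M
  out : X → List M → Bool

/-- The player who translates the input by `f` and then behaves like `p`. -/
def Player.comap {X Y M : Type} (p : Player Y M) (f : X → Y) : Player X M where
  msg x := p.msg (f x)
  out x := p.out (f x)

/-- The answer after `r` further messages that continue the history `h`. The two players
alternate, `p` sends the next message, and whoever would send message `r + 1` gives the answer. -/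
def play {M : Type} : ∀ {S T : Type}, ℕ → Player S M → Player T M → S → T → List M → Bool
  | _, _, 0, p, _, s, _, h => p.out s h
  | _, _, r + 1, p, q, s, t, h => play r q p t s (h ++ [p.msg s h])

theorem play_comap {M : Type} (r : ℕ) : ∀ {S S' T T' : Type} (p : Player S' M) (q : Player T' M)
    (f : S → S') (g : T → T') (s : S) (t : T) (h : List M),
    play r (p.comap f) (q.comap g) s t h = play r p q (f s) (g t) h := by
  induction r with
  | zero => intros; rfl
  | succ r ih => intros; exact ih ..

/-- A distributional two-player problem: a uniformly random seed `ω` determines the input `s ω` of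
the player who speaks first, the input `t ω` of the other one, and the bit to be found. -/
structure Game where
  S : Type
  T : Type
  Seed : Type
  fintypeSeed : Fintype Seed
  nonemptySeed : Nonempty Seed
  s : Seed → S
  t : Seed → T
  bit : Seed → Bool

attribute [instance] Game.fintypeSeed Game.nonemptySeed

/-- The entries of `A` with index greater than `i`; the other entries are hidden. -/
def suffix {T : Type} {k : ℕ} (i : Fin k) (A : Fin k → T) : Fin k → Option T :=
  fun j => if i < j then some (A j) else none

theorem suffix_congr {T : Type} {k : ℕ} {i : Fin k} {A B : Fin k → T}
    (h : ∀ j, i < j → A j = B j) : suffix i A = suffix i B := by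
  funext j
  by_cases hj : i < j <;> simp [suffix, hj, h]

/-- The indexed composition of a game: the first speaker holds `k` independent listener inputs
of `G`. The other player holds an index `i`, the entries after position `i`, and the speaker input
of `G` that belongs to entry `i`. They play `G` at entry `i`, with the roles exchanged. -/
def Game.comp (k : ℕ) [NeZero k] (G : Game) : Game where
  S := Fin k → G.T
  T := Fin k × (Fin k → Option G.T) × G.S
  Seed := Fin k × (Fin k → G.Seed)
  fintypeSeed := inferInstance
  nonemptySeed := inferInstance
  s ω := G.t ∘ ω.2
  t ω := (ω.1, suffix ω.1 (G.t ∘ ω.2), G.s (ω.2 ω.1))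
  bit ω := G.bit (ω.2 ω.1)

/-- The game without messages: guess a random bit held by the opponent. -/
def Game.guess : Game where
  S := Unit
  T := Bool
  Seed := Bool
  fintypeSeed := inferInstance
  nonemptySeed := inferInstance
  s _ := ()
  t b := b
  bit b := b

/-- The `r`-fold indexed composition, to be played with `r` messages. -/
def nestedGame (k : ℕ) [NeZero k] : ℕ → Game
  | 0 => Game.guess
  | r + 1 => (nestedGame k r).comp k

open Classical in
/-- The number of seeds on which the answer after `r` messages is correct. -/
noncomputable def Game.score {M : Type} (G : Game) (r : ℕ) (p : Player G.S M) (q : Player G.T M)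
    (h : List M) : ℝ :=
  ∑ ω : G.Seed, if play r p q (G.s ω) (G.t ω) h = G.bit ω then 1 else 0

theorem Game.score_guess_le {M : Type} (p : Player Game.guess.S M) (q : Player Game.guess.T M)
    (h : List M) : Game.guess.score 0 p q h ≤ 1 / 2 * Fintype.card Game.guess.Seed := by
  have hc : Fintype.card Game.guess.Seed = 2 := Fintype.card_bool
  have : Game.guess.score 0 p q h
      = ∑ b : Bool, if p.out () h = b then 1 else 0 := by
    unfold Game.score
    refine Finset.sum_congr rfl fun ω _ => ?_
    simp only [play, Game.guess]
    congr
  rw [this, hc]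
  cases p.out () h <;> simp

/-! ### Round elimination -/

/-- The best way to complete a listener input `x` of the subgame to an input of the first speaker
that has the suffix `c` at index `i` and on which the first message is `m`. -/
theorem exists_best_completion {M : Type} (k : ℕ) [NeZero k] (G : Game) (msg : (Fin k → G.T) → M)
    (val : (Fin k → G.T) → ℝ) (m : M) (i : Fin k) (c : Fin k → Option G.T) (x : G.T) :
    ∃ B : Fin k → G.T, ∀ η : Fin k → G.Seed, suffix i (G.t ∘ η) = c → G.t (η i) = x →
      msg (G.t ∘ η) = m → val (G.t ∘ η) ≤ val B := by
  classical
  let F : Finset (Fin k → G.Seed) := Finset.univ.filter fun η =>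
    suffix i (G.t ∘ η) = c ∧ G.t (η i) = x ∧ msg (G.t ∘ η) = m
  rcases F.eq_empty_or_nonempty with hF | hF
  · refine ⟨fun _ => x, fun η h1 h2 h3 => ?_⟩
    have : η ∈ F := by simp [F, h1, h2, h3]
    simp [hF] at this
  · obtain ⟨η₀, -, h⟩ := F.exists_max_image (fun η => val (G.t ∘ η)) hF
    exact ⟨G.t ∘ η₀, fun η h1 h2 h3 => h η (by simp [F, h1, h2, h3])⟩

open Classical in
/-- The first message of the composed game can be dropped: the players of `G` agree on an index
`i`, a suffix and a first message, and the listener's input is completed optimally. The loss is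
the correlation of the first message with entry `i` given the later ones. -/
theorem Game.score_comp_le {M : Type} [Fintype M] [Nonempty M] (k : ℕ) [NeZero k] (G : Game)
    (r : ℕ) (β : ℝ)
    (hG : ∀ (p : Player G.S M) (q : Player G.T M) (h : List M),
      G.score r p q h ≤ β * Fintype.card G.Seed)
    {c : ℝ} (hc : 0 < c) (p : Player (G.comp k).S M) (q : Player (G.comp k).T M) (h : List M) :
    (G.comp k).score (r + 1) p q h ≤
      (β + (Real.log (Fintype.card M) / (c * k) + c / 2)) * Fintype.card (G.comp k).Seed := by
  let msg : (Fin k → G.T) → M := fun A => p.msg A h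
  -- The indicator of success at entry `i` when the speaker pretends to hold `B`.
  let win : M → Fin k → (Fin k → Option G.T) → (Fin k → G.T) → G.Seed → ℝ := fun m i d B v =>
    if play r q p (i, d, G.s v) B (h ++ [m]) = G.bit v then 1 else 0
  have win_nonneg : ∀ m i d B v, 0 ≤ win m i d B v := fun m i d B v => by
    simp only [win]; split_ifs <;> norm_num
  have win_le : ∀ m i d B v, win m i d B v ≤ 1 := fun m i d B v => by
    simp only [win]; split_ifs <;> norm_num
  choose best hbest using fun (m : M) (i : Fin k) (d : Fin k → Option G.T) (x : G.T) =>
    exists_best_completion k G msg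
      (fun B => ∑ v ∈ Finset.univ.filter (fun v => G.t v = x), win m i d B v) m i d x
  let f : M → Fin k → (Fin k → G.Seed) → ℝ := fun m i ω =>
    win m i (suffix i (G.t ∘ ω)) (best m i (suffix i (G.t ∘ ω)) (G.t (ω i))) (ω i)
  have suffix_update : ∀ (i : Fin k) (ω : Fin k → G.Seed) v,
      suffix i (G.t ∘ Function.update ω i v) = suffix i (G.t ∘ ω) := fun i ω v =>
    suffix_congr fun j hj => by simp [Function.update_of_ne hj.ne']
  have f_update : ∀ m i ω v, f m i (Function.update ω i v)
      = win m i (suffix i (G.t ∘ ω)) (best m i (suffix i (G.t ∘ ω)) (G.t v)) v := by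
    intro m i ω v
    simp only [f, suffix_update, Function.update_self]
  have f_dep : ∀ m i ω ω', (∀ j, i ≤ j → ω j = ω' j) → f m i ω = f m i ω' := by
    intro m i ω ω' hω
    have : suffix i (G.t ∘ ω) = suffix i (G.t ∘ ω') :=
      suffix_congr fun j hj => by simp [hω j hj.le]
    simp only [f, this, hω i le_rfl]
  set n : ℝ := (Fintype.card G.Seed : ℝ) with hn
  have hn0 : 0 < n := by rw [hn]; exact_mod_cast Fintype.card_pos
  -- The mean success probability of the subgame with the data `m`, `i`, `ω` made public.
  let avg : M → Fin k → (Fin k → G.Seed) → ℝ := fun m i ω =>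
    (∑ v, f m i (Function.update ω i v)) / n
  have avg_le : ∀ m i ω, avg m i ω ≤ β := by
    intro m i ω
    rw [div_le_iff₀ hn0]
    let enc : G.S → (G.comp k).T := fun y => (i, suffix i (G.t ∘ ω), y)
    let dec : G.T → (G.comp k).S := best m i (suffix i (G.t ∘ ω))
    refine (Finset.sum_congr rfl fun v _ => ?_).trans_le
      (hG (q.comap enc) (p.comap dec) (h ++ [m]))
    rw [f_update]
    exact (congrArg (fun b => if b = G.bit v then (1 : ℝ) else 0)
      (play_comap r q p enc dec (G.s v) (G.t v) (h ++ [m]))).symm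
  have avg_nonneg : ∀ m i ω, 0 ≤ avg m i ω := fun m i ω =>
    div_nonneg (Finset.sum_nonneg fun v _ => win_nonneg ..) hn0.le
  have avg_le_one : ∀ m i ω, avg m i ω ≤ 1 := by
    intro m i ω
    rw [div_le_iff₀ hn0, one_mul, hn]
    calc ∑ v, f m i (Function.update ω i v) ≤ ∑ _v : G.Seed, (1 : ℝ) :=
          Finset.sum_le_sum fun v _ => win_le ..
      _ = _ := by simp
  have avg_update : ∀ m i ω v, avg m i (Function.update ω i v) = avg m i ω := by
    intro m i ω v
    simp only [avg, Function.update_idem]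
  have main := sum_selected_le k (fun m i ω => f m i ω - avg m i ω)
    (fun m i ω => by
      have h1 := win_nonneg m i (suffix i (G.t ∘ ω))
        (best m i (suffix i (G.t ∘ ω)) (G.t (ω i))) (ω i)
      have h2 := win_le m i (suffix i (G.t ∘ ω))
        (best m i (suffix i (G.t ∘ ω)) (G.t (ω i))) (ω i)
      have h3 := avg_nonneg m i ω
      have h4 := avg_le_one m i ω
      rw [abs_le]
      constructor <;> simp only [f] <;> linarith)
    (fun m i ω ω' hω => by
      have h1 : avg m i ω = avg m i ω' := by
        simp only [avg]
        congr 1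
        refine Finset.sum_congr rfl fun v _ => f_dep _ _ _ _ fun j hj => ?_
        by_cases hji : j = i
        · subst hji; simp
        · simp [hji, hω j hj]
      simp only [h1, f_dep m i ω ω' hω])
    (fun m i ω => by
      simp only [avg_update, Finset.sum_sub_distrib, Finset.sum_const, Finset.card_univ,
        nsmul_eq_mul, ← hn]
      simp only [avg]
      field_simp
      ring)
    (fun ω => msg (G.t ∘ ω)) hc
  -- Replacing the true input by the best completion does not lower the score.
  have step : ∀ i : Fin k, ∑ ω : Fin k → G.Seed,
      win (msg (G.t ∘ ω)) i (suffix i (G.t ∘ ω)) (G.t ∘ ω) (ω i)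
        ≤ ∑ ω : Fin k → G.Seed, f (msg (G.t ∘ ω)) i ω := by
    intro i
    refine le_of_mul_le_mul_left ?_ hn0
    rw [hn, ← sum_sum_update i, ← sum_sum_update i]
    refine Finset.sum_le_sum fun ω _ => ?_
    rw [← Finset.sum_fiberwise_of_maps_to (t := Finset.univ.image G.t) (g := G.t)
        (fun v _ => Finset.mem_image_of_mem _ (Finset.mem_univ v)),
      ← Finset.sum_fiberwise_of_maps_to (t := Finset.univ.image G.t) (g := G.t)
        (fun v _ => Finset.mem_image_of_mem _ (Finset.mem_univ v))]
    refine Finset.sum_le_sum fun x hx => ?_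
    obtain ⟨v₀, -, rfl⟩ := Finset.mem_image.mp hx
    have comp_update : ∀ v, G.t v = G.t v₀ →
        G.t ∘ Function.update ω i v = G.t ∘ Function.update ω i v₀ := by
      intro v hv
      rw [Function.comp_update, Function.comp_update, hv]
    have key := hbest (msg (G.t ∘ Function.update ω i v₀)) i (suffix i (G.t ∘ ω)) (G.t v₀)
      (Function.update ω i v₀) (suffix_update ..) (by simp) rfl
    refine le_trans (le_of_eq ?_) (key.trans (le_of_eq ?_))
    · refine Finset.sum_congr rfl fun v hv => ?_
      have hv := (Finset.mem_filter.mp hv).2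
      rw [comp_update v hv, suffix_update, Function.update_self]
    · refine Finset.sum_congr rfl fun v hv => ?_
      have hv := (Finset.mem_filter.mp hv).2
      rw [f_update, comp_update v hv, hv]
  have hk : (0 : ℝ) < k := by exact_mod_cast Nat.pos_of_ne_zero (NeZero.ne k)
  set N : ℝ := (Fintype.card (Fin k → G.Seed) : ℝ) with hN
  have hcard : (Fintype.card (G.comp k).Seed : ℝ) = k * N := by
    have : Fintype.card (G.comp k).Seed = Fintype.card (Fin k × (Fin k → G.Seed)) := rfl
    rw [this, Fintype.card_prod, Fintype.card_fin, hN]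
    push_cast; ring
  calc (G.comp k).score (r + 1) p q h
      = ∑ i : Fin k, ∑ ω : Fin k → G.Seed,
          win (msg (G.t ∘ ω)) i (suffix i (G.t ∘ ω)) (G.t ∘ ω) (ω i) :=
        Fintype.sum_prod_type (α₁ := Fin k) (α₂ := Fin k → G.Seed) _
    _ ≤ ∑ i : Fin k, ∑ ω : Fin k → G.Seed, f (msg (G.t ∘ ω)) i ω :=
        Finset.sum_le_sum fun i _ => step i
    _ = ∑ ω : Fin k → G.Seed, ∑ i, (f (msg (G.t ∘ ω)) i ω - avg (msg (G.t ∘ ω)) i ω)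
          + ∑ ω : Fin k → G.Seed, ∑ i, avg (msg (G.t ∘ ω)) i ω := by
        rw [Finset.sum_comm, ← Finset.sum_add_distrib]
        refine Finset.sum_congr rfl fun ω _ => ?_
        rw [← Finset.sum_add_distrib]
        simp
    _ ≤ N * (Real.log (Fintype.card M) / c + k * (c / 2))
          + ∑ _ω : Fin k → G.Seed, ∑ _i : Fin k, β :=
        add_le_add main (Finset.sum_le_sum fun ω _ => Finset.sum_le_sum fun i _ => avg_le ..)
    _ = _ := by
        rw [hcard]
        simp only [Finset.sum_const, Finset.card_univ, nsmul_eq_mul, Fintype.card_fin, ← hN]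
        field_simp
        ring

theorem score_nestedGame_le {M : Type} [Fintype M] [Nonempty M] (k : ℕ) [NeZero k]
    {c : ℝ} (hc : 0 < c) (r : ℕ) (p : Player (nestedGame k r).S M)
    (q : Player (nestedGame k r).T M) (h : List M) :
    (nestedGame k r).score r p q h ≤
      (1 / 2 + r * (Real.log (Fintype.card M) / (c * k) + c / 2)) *
        Fintype.card (nestedGame k r).Seed := by
  induction r generalizing h with
  | zero => exact (Game.score_guess_le p q h).trans (le_of_eq (by
      rw [Nat.cast_zero, zero_mul, add_zero]; rfl))
  | succ r ih =>
    refine (Game.score_comp_le k (nestedGame k r) r _ ih hc p q h).trans (le_of_eq ?_)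
    push_cast
    congr 1
    ring

/-! ### Convex integer curves -/

/-- The increments of `f` lie in `[1, R]` and do not decrease, so `f` is strictly increasing and
convex. -/
structure SlopesIn (R : ℤ) (f : ℕ → ℤ) : Prop where
  one_le : ∀ x, 1 ≤ f (x + 1) - f x
  le : ∀ x, f (x + 1) - f x ≤ R
  mono : ∀ x, f (x + 1) - f x ≤ f (x + 2) - f (x + 1)

theorem SlopesIn.sub_nonneg {R : ℤ} {f : ℕ → ℤ} (hf : SlopesIn R f) (n : ℕ) :
    0 ≤ f n - f 0 := by
  induction n with
  | zero => simp
  | succ n ih => have := hf.one_le n; linarith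

theorem SlopesIn.sub_le {R : ℤ} {f : ℕ → ℤ} (hf : SlopesIn R f) (n : ℕ) :
    f n - f 0 ≤ n * R := by
  induction n with
  | zero => simp
  | succ n ih => have := hf.le n; push_cast; linarith

theorem slopesIn_line {R : ℤ} (hR : 1 ≤ R) : SlopesIn R (fun x => (x : ℤ)) :=
  ⟨fun x => by push_cast; linarith, fun x => by push_cast; linarith,
    fun x => by push_cast; linarith⟩

/-- The curve with increments `d` that takes the value `c` at `x₀`. -/
def ofIncrements (d : ℕ → ℤ) (x₀ : ℕ) (c : ℤ) (x : ℕ) : ℤ :=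
  c + ∑ y ∈ Finset.range x, d y - ∑ y ∈ Finset.range x₀, d y

theorem ofIncrements_self (d : ℕ → ℤ) (x₀ : ℕ) (c : ℤ) : ofIncrements d x₀ c x₀ = c := by
  simp [ofIncrements]

theorem ofIncrements_succ_sub (d : ℕ → ℤ) (x₀ : ℕ) (c : ℤ) (x : ℕ) :
    ofIncrements d x₀ c (x + 1) - ofIncrements d x₀ c x = d x := by
  simp only [ofIncrements, Finset.sum_range_succ]; ring

theorem slopesIn_ofIncrements {R : ℤ} {d : ℕ → ℤ} (h1 : ∀ x, 1 ≤ d x) (h2 : ∀ x, d x ≤ R)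
    (h3 : ∀ x, d x ≤ d (x + 1)) (x₀ : ℕ) (c : ℤ) : SlopesIn R (ofIncrements d x₀ c) where
  one_le x := by rw [ofIncrements_succ_sub]; exact h1 x
  le x := by rw [ofIncrements_succ_sub]; exact h2 x
  mono x := by rw [ofIncrements_succ_sub, ofIncrements_succ_sub d x₀ c (x + 1)]; exact h3 x

theorem sub_eq_of_increments_eq {f g : ℕ → ℤ} {a n : ℕ}
    (h : ∀ l < n, f (a + l + 1) - f (a + l) = g (l + 1) - g l) {l : ℕ} (hl : l ≤ n) :
    f (a + l) - f a = g l - g 0 := by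
  induction l with
  | zero => simp
  | succ l ih =>
    have h1 := ih (by omega)
    have h2 := h l (by omega)
    rw [← add_assoc]
    linarith

/-! ### Concatenation of blocks -/

/-- The increments of the curve that consists of `k` blocks of length `N`, where block `j` is the
curve `W j` scaled by `R ^ j`. If `W` is a line of slope one from index `k` on, then the last
block is followed by a line of slope `R ^ k`. -/
def blockIncrement (k N : ℕ) (R : ℤ) (W : ℕ → ℕ → ℤ) (y : ℕ) : ℤ :=
  R ^ min (y / N) k * (W (y / N) (y % N + 1) - W (y / N) (y % N))

theorem blockIncrement_mul_add {k N : ℕ} {R : ℤ} {W : ℕ → ℕ → ℤ} {j l : ℕ} (hl : l < N) :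
    blockIncrement k N R W (j * N + l) = R ^ min j k * (W j (l + 1) - W j l) := by
  have h1 : (j * N + l) / N = j := by
    rw [mul_comm, Nat.mul_add_div (by omega), Nat.div_eq_of_lt hl, add_zero]
  have h2 : (j * N + l) % N = l := by rw [mul_comm, Nat.mul_add_mod, Nat.mod_eq_of_lt hl]
  rw [blockIncrement, h1, h2]

section Blocks

variable {k N : ℕ} {R : ℤ} {W : ℕ → ℕ → ℤ}

theorem one_le_blockIncrement (hR : 1 ≤ R) (hW : ∀ j, SlopesIn R (W j)) (y : ℕ) :
    1 ≤ blockIncrement k N R W y :=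
  one_le_mul_of_one_le_of_one_le (one_le_pow₀ hR) ((hW _).one_le _)

theorem blockIncrement_le (hR : 1 ≤ R) (hW : ∀ j, SlopesIn R (W j)) (y : ℕ) :
    blockIncrement k N R W y ≤ R ^ (k + 1) := by
  rw [pow_succ]
  have h1 := (hW (y / N)).le (y % N)
  have h2 := (hW (y / N)).one_le (y % N)
  exact mul_le_mul (pow_le_pow_right₀ hR (min_le_right _ _)) h1 (by linarith) (by positivity)

theorem blockIncrement_le_succ (hN : 0 < N) (hR : 1 ≤ R) (hW : ∀ j, SlopesIn R (W j))
    (hline : ∀ j, k ≤ j → W j = fun x : ℕ => (x : ℤ)) (y : ℕ) :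
    blockIncrement k N R W y ≤ blockIncrement k N R W (y + 1) := by
  obtain ⟨j, l, hl, rfl⟩ : ∃ j l, l < N ∧ y = j * N + l :=
    ⟨y / N, y % N, Nat.mod_lt _ hN, by rw [mul_comm]; exact (Nat.div_add_mod y N).symm⟩
  rw [blockIncrement_mul_add hl]
  rcases Nat.lt_or_ge (l + 1) N with h | h
  · rw [add_assoc, blockIncrement_mul_add h]
    exact mul_le_mul_of_nonneg_left ((hW j).mono l) (by positivity)
  · have hy : j * N + l + 1 = (j + 1) * N + 0 := by rw [add_mul]; omega
    rw [hy, blockIncrement_mul_add hN]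
    rcases Nat.lt_or_ge j k with hj | hj
    · rw [min_eq_left hj.le, min_eq_left (by omega : j + 1 ≤ k), pow_succ, mul_assoc]
      refine mul_le_mul_of_nonneg_left ?_ (by positivity)
      have h1 := (hW j).le l
      have h2 := (hW (j + 1)).one_le 0
      nlinarith
    · rw [min_eq_right hj, min_eq_right (by omega), hline j hj, hline (j + 1) (by omega)]
      push_cast
      simp

/-- The total increase over the blocks after block `i`. -/
def riseAfter (k N : ℕ) (R : ℤ) (W : ℕ → ℕ → ℤ) (i : ℕ) : ℤ :=
  ∑ j ∈ Finset.Ico (i + 1) k, R ^ j * (W j N - W j 0)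

theorem riseAfter_nonneg (hR : 1 ≤ R) (hW : ∀ j, SlopesIn R (W j)) (i : ℕ) :
    0 ≤ riseAfter k N R W i :=
  Finset.sum_nonneg fun j _ => mul_nonneg (by positivity) ((hW j).sub_nonneg N)

theorem riseAfter_le (hR : 1 ≤ R) (hW : ∀ j, SlopesIn R (W j)) (i : ℕ) :
    riseAfter k N R W i ≤ k * N * R ^ k := by
  calc riseAfter k N R W i ≤ ∑ _j ∈ Finset.Ico (i + 1) k, (N : ℤ) * R ^ k := by
        refine Finset.sum_le_sum fun j hj => ?_
        have hj := (Finset.mem_Ico.mp hj).2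
        calc R ^ j * (W j N - W j 0) ≤ R ^ j * (N * R) :=
              mul_le_mul_of_nonneg_left ((hW j).sub_le N) (by positivity)
          _ = N * R ^ (j + 1) := by ring
          _ ≤ N * R ^ k := by gcongr; omega
    _ ≤ k * N * R ^ k := by
        rw [Finset.sum_const, Nat.card_Ico, nsmul_eq_mul, mul_assoc]
        gcongr
        omega

/-- The curve of the first speaker in a composed game. Its value at the end of the last block is
fixed, and large enough to leave room for the last increment of the listener's curve. -/
def blockCurve (k N : ℕ) (R : ℤ) (W : ℕ → ℕ → ℤ) : ℕ → ℤ :=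
  ofIncrements (blockIncrement k N R W) (k * N) (3 * R ^ (k + 1))

theorem blockCurve_mul_add {j l : ℕ} (hj : j < k) (hl : l ≤ N) :
    blockCurve k N R W (j * N + l) - blockCurve k N R W (j * N) = R ^ j * (W j l - W j 0) := by
  rw [mul_sub]
  refine sub_eq_of_increments_eq (g := fun l => R ^ j * W j l) (n := N) (fun l hl => ?_) hl
  rw [blockCurve, ofIncrements_succ_sub, blockIncrement_mul_add hl, min_eq_left hj.le, mul_sub]

theorem blockCurve_succ_mul {i : ℕ} (hi : i < k) :
    blockCurve k N R W ((i + 1) * N) = 3 * R ^ (k + 1) - riseAfter k N R W i := by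
  have h := Finset.sum_Ico_sub (fun j => blockCurve k N R W (j * N)) (Nat.succ_le_of_lt hi)
  have h2 : blockCurve k N R W (k * N) = 3 * R ^ (k + 1) := ofIncrements_self ..
  have h3 : riseAfter k N R W i = ∑ j ∈ Finset.Ico (i + 1) k,
      (blockCurve k N R W ((j + 1) * N) - blockCurve k N R W (j * N)) := by
    refine Finset.sum_congr rfl fun j hj => ?_
    rw [← blockCurve_mul_add (Finset.mem_Ico.mp hj).2 le_rfl, add_mul, one_mul]
  rw [h3, h, h2]
  ring

/-! ### The curve that looks at one block -/

/-- The increments of a curve that follows `f`, scaled by `R ^ i`, in block `i`. It has slope one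
before this block and slope `R ^ (i + 1)` after it. The increment at the end of the last block is
the free parameter `X`. -/
def focusIncrement (k N : ℕ) (R : ℤ) (i : ℕ) (f : ℕ → ℤ) (X : ℤ) (y : ℕ) : ℤ :=
  if y < i * N then 1
  else if y < (i + 1) * N then R ^ i * (f (y - i * N + 1) - f (y - i * N))
  else if y < k * N then R ^ (i + 1)
  else if y = k * N then X
  else R ^ (k + 2)

/-- The increment at the end of the last block that makes the curve of the listener and the curve
of the first speaker add up to a scaled copy of the subgame in block `i`. -/
def lastIncrement (k N : ℕ) (R : ℤ) (W : ℕ → ℕ → ℤ) (i : ℕ) (f : ℕ → ℤ) : ℤ :=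
  3 * R ^ (k + 1) - riseAfter k N R W i - (k - (i + 1)) * N * R ^ (i + 1) - R ^ i * f N

/-- The curve of the listener in a composed game; its value at `k * N + 1` is zero. -/
def focusCurve (k N : ℕ) (R : ℤ) (W : ℕ → ℕ → ℤ) (i : ℕ) (f : ℕ → ℤ) : ℕ → ℤ :=
  ofIncrements (focusIncrement k N R i f (lastIncrement k N R W i f)) (k * N + 1) 0

/-- The last increment fits between the slopes around it, so the listener's curve is convex. The
choice of the height `3 * R ^ (k + 1)` is made for the lower bound. -/
theorem lastIncrement_bounds (hR : 4 ≤ R) (hNR : 4 * (k * N : ℤ) ≤ R)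
    (hW : ∀ j, SlopesIn R (W j)) {f : ℕ → ℤ} (hf : |f N| ≤ R) {i : ℕ} (hi : i < k) :
    R ^ k ≤ lastIncrement k N R W i f ∧ lastIncrement k N R W i f ≤ R ^ (k + 2) := by
  have hR1 : 1 ≤ R := by linarith
  have h1 := riseAfter_nonneg (k := k) (N := N) hR1 hW i
  have h2 := riseAfter_le (k := k) (N := N) hR1 hW i
  have hik : (0 : ℤ) ≤ k - (i + 1) := by have : (i : ℤ) + 1 ≤ k := by exact_mod_cast hi
                                         linarith
  have hP : 0 < R ^ k := by positivity
  have h3 : (k - (i + 1) : ℤ) * N * R ^ (i + 1) ≤ k * N * R ^ k := by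
    gcongr
    · linarith
    · exact hi
  have h4 : (0 : ℤ) ≤ (k - (i + 1) : ℤ) * N * R ^ (i + 1) := by positivity
  obtain ⟨h5, h6⟩ := abs_le.mp hf
  have h7 : R ^ i ≤ R ^ k := pow_le_pow_right₀ hR1 hi.le
  have h8 : |R ^ i * f N| ≤ R ^ k * R := by
    rw [abs_mul, abs_of_nonneg (by positivity : (0 : ℤ) ≤ R ^ i)]
    exact mul_le_mul h7 hf (abs_nonneg _) hP.le
  obtain ⟨h9, h10⟩ := abs_le.mp h8
  have h11 : R ^ k * (4 * (k * N : ℤ)) ≤ R ^ k * R := mul_le_mul_of_nonneg_left hNR hP.le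
  have h12 : R ^ k * R * 4 ≤ R ^ k * R * R := mul_le_mul_of_nonneg_left hR (by positivity)
  have h13 : R ^ k * 4 ≤ R ^ k * R := mul_le_mul_of_nonneg_left hR hP.le
  rw [lastIncrement, pow_succ R (k + 1), pow_succ R k]
  constructor <;> linarith

section Focus

variable {i : ℕ} {f : ℕ → ℤ} {X : ℤ}

theorem focusIncrement_mul_add {l : ℕ} (hl : l < N) :
    focusIncrement k N R i f X (i * N + l) = R ^ i * (f (l + 1) - f l) := by
  rw [focusIncrement, if_neg (by omega), if_pos (by rw [add_mul]; omega), Nat.add_sub_cancel_left]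

theorem slopesIn_focus (hR : 1 ≤ R) (hi : i < k) (hf : SlopesIn R f) (hX : R ^ k ≤ X)
    (hX' : X ≤ R ^ (k + 2)) (x₀ : ℕ) (c : ℤ) :
    SlopesIn (R ^ (k + 2)) (ofIncrements (focusIncrement k N R i f X) x₀ c) := by
  have hk : (i + 1) * N ≤ k * N := Nat.mul_le_mul_right _ hi
  have hs : (i + 1) * N = i * N + N := by ring
  have hpow : ∀ {m}, m ≤ k + 2 → R ^ m ≤ R ^ (k + 2) := fun h => pow_le_pow_right₀ hR h
  have hpow1 : ∀ m, 1 ≤ R ^ m := fun m => one_le_pow₀ hR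
  have inner_le : ∀ x, R ^ i * (f (x + 1) - f x) ≤ R ^ (i + 1) := fun x => by
    rw [pow_succ]; exact mul_le_mul_of_nonneg_left (hf.le x) (by positivity)
  have one_le_inner : ∀ x, 1 ≤ R ^ i * (f (x + 1) - f x) := fun x =>
    one_le_mul_of_one_le_of_one_le (hpow1 i) (hf.one_le x)
  have hik : R ^ (i + 1) ≤ R ^ k := pow_le_pow_right₀ hR hi
  apply slopesIn_ofIncrements
  · intro x
    unfold focusIncrement
    split_ifs
    · exact le_rfl
    · exact one_le_inner _
    · exact hpow1 _
    · exact (hpow1 k).trans hX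
    · exact hpow1 _
  · intro x
    unfold focusIncrement
    split_ifs
    · exact hpow1 _
    · exact (inner_le _).trans (hpow (by omega))
    · exact hpow (by omega)
    · exact hX'
    · exact le_rfl
  · intro x
    unfold focusIncrement
    split_ifs <;> first
      | omega
      | exact le_rfl
      | exact one_le_inner _
      | exact hpow1 _
      | exact (hpow1 k).trans hX
      | exact inner_le _
      | exact (inner_le _).trans (hik.trans hX)
      | exact hik.trans hX
      | exact hX'
      | exact (inner_le _).trans (hpow (by omega))
      | skip
    · have : x + 1 - i * N = x - i * N + 1 := by omega
      rw [this]
      exact mul_le_mul_of_nonneg_left (hf.mono _) (by positivity)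

end Focus

/-- In block `i` the two curves of the composed game add up to the scaled sum of the two curves of
the subgame. The listener's curve uses only the blocks after block `i`. -/
theorem blockCurve_add_focusCurve {W' : ℕ → ℕ → ℤ} {i l : ℕ} {f : ℕ → ℤ} (hi : i < k)
    (hl : l ≤ N) (hW : W i N = 0) (hWW' : ∀ j, i < j → W' j = W j) :
    blockCurve k N R W (i * N + l) + focusCurve k N R W' i f (i * N + l)
      = R ^ i * (f l + W i l) := by
  set X := lastIncrement k N R W' i f with hX
  have hrise : riseAfter k N R W' i = riseAfter k N R W i :=
    Finset.sum_congr rfl fun j hj => by rw [hWW' j (Finset.mem_Ico.mp hj).1]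
  have hs : (i + 1) * N = i * N + N := by ring
  have hk : (i + 1) * N ≤ k * N := Nat.mul_le_mul_right _ hi
  have v1 : focusCurve k N R W' i f (k * N + 1) = 0 := ofIncrements_self ..
  have v2 : focusCurve k N R W' i f (k * N + 1) - focusCurve k N R W' i f (k * N) = X := by
    rw [focusCurve, ofIncrements_succ_sub, focusIncrement, if_neg (by omega), if_neg (by omega),
      if_neg (by omega), if_pos rfl]
  have v3 : focusCurve k N R W' i f (k * N) - focusCurve k N R W' i f ((i + 1) * N)
      = (k - (i + 1)) * N * R ^ (i + 1) := by
    have := sub_eq_of_increments_eq (f := focusCurve k N R W' i f)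
      (g := fun l => (l : ℤ) * R ^ (i + 1)) (a := (i + 1) * N) (n := k * N - (i + 1) * N)
      (fun l hl => by
        rw [focusCurve, ofIncrements_succ_sub, focusIncrement, if_neg (by omega),
          if_neg (by omega), if_pos (by omega)]
        push_cast; ring) le_rfl
    rw [Nat.add_sub_cancel' hk] at this
    rw [this, Nat.cast_sub hk]
    push_cast; ring
  have v4 : ∀ l ≤ N, focusCurve k N R W' i f (i * N + l) - focusCurve k N R W' i f (i * N)
      = R ^ i * f l - R ^ i * f 0 := fun l hl =>
    sub_eq_of_increments_eq (g := fun l => R ^ i * f l) (n := N) (fun l hl => by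
      rw [focusCurve, ofIncrements_succ_sub, focusIncrement_mul_add hl, mul_sub]) hl
  have v5 := v4 N le_rfl
  have v6 := v4 l hl
  have u1 := blockCurve_succ_mul (N := N) (R := R) (W := W) hi
  have u2 := blockCurve_mul_add (R := R) (W := W) hi hl
  have u3 := blockCurve_mul_add (R := R) (W := W) hi (le_refl N)
  rw [← hs] at v5 u3
  rw [lastIncrement, hrise] at hX
  rw [hW] at u3
  linarith

end Blocks

/-! ### Realization of the games by curves -/

/-- A realization of a game by pairs of curves of length `N`: the sum of the two curves changes
its sign at an index that determines the hidden bit. The listener's curves have a fixed right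
end, and all the curves have controlled increments. -/
structure Realization (G : Game) (N : ℕ) (R : ℤ) where
  u : G.S → ℕ → ℤ
  v : G.T → ℕ → ℤ
  decode : ℕ → Bool
  slopes_u : ∀ s, SlopesIn R (u s)
  slopes_v : ∀ t, SlopesIn R (v t)
  u_end : ∀ s, |u s N| ≤ R
  v_end : ∀ t, v t N = 0
  cross : ∀ ω, ∃ x < N, u (G.s ω) x + v (G.t ω) x ≤ 0 ∧
    0 < u (G.s ω) (x + 1) + v (G.t ω) (x + 1) ∧ decode x = G.bit ω

theorem realization_guess {R : ℤ} (hR : 4 ≤ R) : Nonempty (Realization Game.guess 2 R) := by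
  refine ⟨{
    u := fun _ x => x + 2
    v := fun (b : Bool) x => if b then (if x ≤ 1 then x - 4 else 3 * x - 6) else 2 * x - 4
    decode := fun x => x == 1
    slopes_u := fun _ => ⟨fun x => ?_, fun x => ?_, fun x => ?_⟩
    slopes_v := fun b => ⟨fun x => ?_, fun x => ?_, fun x => ?_⟩
    u_end := fun _ => by rw [abs_le]; push_cast; constructor <;> linarith
    v_end := fun b => by cases b <;> simp
    cross := fun b => ?_ }⟩
  · push_cast; linarith
  · push_cast; linarith
  · push_cast; linarith
  · cases b <;> simp <;> (try split_ifs) <;> omega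
  · cases b <;> simp <;> (try split_ifs) <;> omega
  · cases b <;> simp <;> (try split_ifs) <;> omega
  · cases b
    · exact ⟨0, by norm_num, by simp [Game.guess]⟩
    · exact ⟨1, by norm_num, by simp [Game.guess]⟩

/-- The family of block curves of a list of inputs; hidden inputs and the indices from `k` on give
a line. -/
def inputCurves {T : Type} {k : ℕ} (v : T → ℕ → ℤ) (c : Fin k → Option T) (j : ℕ) : ℕ → ℤ :=
  if h : j < k then (c ⟨j, h⟩).elim (fun x => (x : ℤ)) v else fun x => x

theorem slopesIn_inputCurves {T : Type} {k : ℕ} {R : ℤ} (hR : 1 ≤ R) {v : T → ℕ → ℤ}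
    (hv : ∀ t, SlopesIn R (v t)) (c : Fin k → Option T) (j : ℕ) :
    SlopesIn R (inputCurves v c j) := by
  unfold inputCurves
  split_ifs with h
  · cases c ⟨j, h⟩ with
    | none => exact slopesIn_line hR
    | some t => exact hv t
  · exact slopesIn_line hR

/-- Composition of games preserves realizability. The index of the crossing modulo `N` is the index
of the crossing in the subgame. -/
theorem realization_comp {G : Game} {N k : ℕ} [NeZero k] {R : ℤ} (hR : 4 ≤ R)
    (hNR : 4 * (k * N : ℤ) ≤ R) (h : Nonempty (Realization G N R)) :
    Nonempty (Realization (G.comp k) (k * N + 1) (R ^ (k + 2))) := by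
  obtain ⟨ρ⟩ := h
  have hR1 : 1 ≤ R := by linarith
  have hN : 0 < N := by
    obtain ⟨ω⟩ := G.nonemptySeed
    obtain ⟨x, hx, -⟩ := ρ.cross ω
    omega
  have hW : ∀ (c : Fin k → Option G.T) j, SlopesIn R (inputCurves ρ.v c j) :=
    slopesIn_inputCurves hR1 ρ.slopes_v
  have hline : ∀ (c : Fin k → Option G.T) j, k ≤ j → inputCurves ρ.v c j = fun x : ℕ => (x : ℤ) :=
    fun c j hj => by rw [inputCurves, dif_neg (by omega)]
  have hcross : ∀ (i : Fin k) (ω : Fin k → G.Seed), ∃ x < k * N + 1,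
      blockCurve k N R (inputCurves ρ.v fun j => some (G.t (ω j))) x
          + focusCurve k N R (inputCurves ρ.v (suffix i (G.t ∘ ω))) i (ρ.u (G.s (ω i))) x ≤ 0 ∧
        0 < blockCurve k N R (inputCurves ρ.v fun j => some (G.t (ω j))) (x + 1)
          + focusCurve k N R (inputCurves ρ.v (suffix i (G.t ∘ ω))) i (ρ.u (G.s (ω i))) (x + 1) ∧
        ρ.decode (x % N) = G.bit (ω i) := by
    intro i ω
    obtain ⟨x, hx, h1, h2, h3⟩ := ρ.cross (ω i)
    have hval : inputCurves ρ.v (fun j => some (G.t (ω j))) i = ρ.v (G.t (ω i)) := by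
      rw [inputCurves, dif_pos i.2]; rfl
    have hend : inputCurves ρ.v (fun j => some (G.t (ω j))) i N = 0 := by
      rw [hval, ρ.v_end]
    have hsuf : ∀ j, (i : ℕ) < j → inputCurves ρ.v (suffix i (G.t ∘ ω)) j
        = inputCurves ρ.v (fun j => some (G.t (ω j))) j := by
      intro j hij
      unfold inputCurves
      split_ifs with hj
      · have : i < ⟨j, hj⟩ := hij
        simp [suffix, this]
      · rfl
    have hadd : ∀ l ≤ N, _ := fun l hl => blockCurve_add_focusCurve (R := R)
      (f := ρ.u (G.s (ω i))) i.2 hl hend hsuf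
    have hiN : ((i : ℕ) + 1) * N ≤ k * N := Nat.mul_le_mul_right _ i.2
    have hsucc : ((i : ℕ) + 1) * N = i * N + N := by ring
    have hP : 0 < R ^ (i : ℕ) := by positivity
    refine ⟨i * N + x, by omega, ?_, ?_, ?_⟩
    · rw [hadd x hx.le, hval]
      exact mul_nonpos_of_nonneg_of_nonpos hP.le h1
    · rw [add_assoc, hadd (x + 1) hx, hval]
      exact mul_pos hP h2
    · rw [mul_comm, Nat.mul_add_mod, Nat.mod_eq_of_lt hx, h3]
  exact ⟨{
    u := fun A => blockCurve k N R (inputCurves ρ.v fun j => some (A j))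
    v := fun y => focusCurve k N R (inputCurves ρ.v y.2.1) y.1 (ρ.u y.2.2)
    decode := fun x => ρ.decode (x % N)
    slopes_u := fun A => slopesIn_ofIncrements (one_le_blockIncrement hR1 (hW _))
      (fun x => (blockIncrement_le hR1 (hW _) x).trans (pow_le_pow_right₀ hR1 (by omega)))
      (blockIncrement_le_succ hN hR1 (hW _) (hline _)) _ _
    slopes_v := fun y => by
      obtain ⟨h1, h2⟩ := lastIncrement_bounds hR hNR (hW y.2.1) (ρ.u_end y.2.2) y.1.2
      exact slopesIn_focus hR1 y.1.2 (ρ.slopes_u _) h1 h2 _ _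
    u_end := fun A => by
      have h1 := ofIncrements_succ_sub
        (blockIncrement k N R (inputCurves ρ.v fun j => some (A j))) (k * N) (3 * R ^ (k + 1))
        (k * N)
      have h2 := one_le_blockIncrement (k := k) (N := N) hR1
        (hW fun j => some (A j)) (k * N)
      have h3 := blockIncrement_le (k := k) (N := N) hR1 (hW fun j => some (A j)) (k * N)
      have h4 : 0 < R ^ (k + 1) := by positivity
      have h5 : R ^ (k + 1) * 4 ≤ R ^ (k + 2) := by
        rw [pow_succ R (k + 1)]; exact mul_le_mul_of_nonneg_left hR h4.le
      rw [ofIncrements_self] at h1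
      rw [abs_le, blockCurve]
      constructor <;> linarith
    v_end := fun y => ofIncrements_self ..
    cross := fun ω => hcross ω.1 ω.2 }⟩

/-- The length of the curves that realize the `r`-fold composition. -/
def curveLength (k : ℕ) : ℕ → ℕ
  | 0 => 2
  | r + 1 => k * curveLength k r + 1

theorem curveLength_add_one_le {k : ℕ} (hk : 2 ≤ k) (r : ℕ) :
    curveLength k r + 1 ≤ 3 * k ^ r := by
  induction r with
  | zero => simp [curveLength]
  | succ r ih =>
    calc k * curveLength k r + 1 + 1 ≤ k * (curveLength k r + 1) := by linarith
      _ ≤ k * (3 * k ^ r) := Nat.mul_le_mul_left _ ih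
      _ = 3 * k ^ (r + 1) := by ring

/-- The slope bound of each level exceeds the length by the factor that the next composition
needs. -/
theorem four_mul_curveLength_le {k : ℕ} (hk : 1 ≤ k) (r : ℕ) :
    4 * (k * curveLength k r) ≤ 2 ^ ((k + 2) ^ r * (k + 4)) := by
  induction r with
  | zero =>
    have := Nat.lt_two_pow_self (n := k)
    simp only [curveLength, pow_zero, one_mul, pow_add]
    omega
  | succ r ih =>
    set a := 2 ^ ((k + 2) ^ r * (k + 4)) with ha
    have h1 : 2 ^ ((k + 2) ^ (r + 1) * (k + 4)) = a ^ (k + 2) := by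
      rw [ha, ← pow_mul]; congr 1; ring
    have hc : 1 ≤ curveLength k r := by cases r <;> simp [curveLength]
    rw [h1, curveLength]
    have hpos : 1 ≤ k * curveLength k r := Nat.mul_pos hk hc
    calc 4 * (k * (k * curveLength k r + 1)) ≤ (4 * (k * curveLength k r)) ^ 2 := by nlinarith
      _ ≤ a ^ 2 := Nat.pow_le_pow_left ih 2
      _ ≤ a ^ (k + 2) := Nat.pow_le_pow_right (by positivity) (by omega)

theorem realization_nestedGame (k : ℕ) [NeZero k] (r : ℕ) :
    Nonempty (Realization (nestedGame k r) (curveLength k r) (2 ^ ((k + 2) ^ r * (k + 4)))) := by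
  have hk : 1 ≤ k := Nat.one_le_iff_ne_zero.mpr (NeZero.ne k)
  have h4 : ∀ r, (4 : ℤ) ≤ 2 ^ ((k + 2) ^ r * (k + 4)) := fun r => by
    calc (4 : ℤ) = 2 ^ 2 := by norm_num
      _ ≤ _ := pow_le_pow_right₀ (by norm_num) (by
        have : 1 ≤ (k + 2) ^ r := Nat.one_le_pow _ _ (by omega)
        nlinarith)
  induction r with
  | zero => exact realization_guess (h4 0)
  | succ r ih =>
    have := realization_comp (h4 r) (by exact_mod_cast four_mul_curveLength_le hk r) ih
    rw [← pow_mul] at this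
    have he : (k + 2) ^ (r + 1) * (k + 4) = (k + 2) ^ r * (k + 4) * (k + 2) := by ring
    rw [he]
    exact this

/-! ### From curves to instances of the intersection problem -/

/-- Alice's sequence for an increasing convex integer curve. -/
def aliceSeq (n : ℕ) (f : ℕ → ℤ) : Fin n → ℚ := fun j => (f j : ℚ)

/-- Bob's sequence for an increasing convex integer curve; the sign makes it decreasing and
concave. -/
def bobSeq (n : ℕ) (f : ℕ → ℤ) : Fin n → ℚ := fun j => ((-f j : ℤ) : ℚ)

theorem crossings_le_of_mem {n : ℕ} {a b : Fin n → ℚ} (ha : StrictMono a) (hb : StrictAnti b)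
    {i j : Fin n} (hi : i ∈ crossings a b) (hj : j ∈ crossings a b) : i ≤ j := by
  by_contra! hlt
  obtain ⟨-, h, hab⟩ := hj
  have hle : (⟨j + 1, h⟩ : Fin n) ≤ i := by
    rw [Fin.le_def]; exact hlt
  have h1 := ha.monotone hle
  have h2 := hb.antitone hle
  have h3 := hi.1
  linarith

theorem SlopesIn.abs_le {R : ℤ} {f : ℕ → ℤ} (hf : SlopesIn R f) {n N x : ℕ} (hN : N < n)
    (hx : x < n) (hR : 0 ≤ R) (hfN : |f N| ≤ R) : |f x| ≤ (n + 1) * R := by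
  have h1 := hf.sub_nonneg x
  have h2 := hf.sub_le x
  have h3 := hf.sub_nonneg N
  have h4 := hf.sub_le N
  have h5 : (x : ℤ) * R ≤ n * R := by gcongr
  have h6 : (N : ℤ) * R ≤ n * R := by gcongr
  obtain ⟨h7, h8⟩ := _root_.abs_le.mp hfN
  rw [_root_.abs_le]
  constructor <;> linarith

theorem add_one_mul_two_pow_lt {n e : ℕ} (hn : 3 ≤ n) (he : e ≤ n * n) :
    (n + 1) * 2 ^ e < 2 ^ n ^ 3 := by
  calc (n + 1) * 2 ^ e ≤ 2 ^ n * 2 ^ (n * n) :=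
        Nat.mul_le_mul Nat.lt_two_pow_self (Nat.pow_le_pow_right (by norm_num) he)
    _ = 2 ^ (n + n * n) := (pow_add _ _ _).symm
    _ < 2 ^ n ^ 3 := Nat.pow_lt_pow_right (by norm_num) (by nlinarith [Nat.mul_le_mul hn hn])

theorem valid_of_slopesIn {n N e x : ℕ} {f g : ℕ → ℤ} (hn : 3 ≤ n) (hN : N < n)
    (he : e ≤ n * n) (hf : SlopesIn (2 ^ e) f) (hg : SlopesIn (2 ^ e) g) (hfN : |f N| ≤ 2 ^ e)
    (hgN : |g N| ≤ 2 ^ e) (hx : x < N) (h0 : f x + g x ≤ 0) (h1 : 0 < f (x + 1) + g (x + 1)) :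
    (TCIBits n (n ^ 3)).valid (aliceSeq n f) (bobSeq n g) ∧
      ∀ z, (TCIBits n (n ^ 3)).correct (aliceSeq n f) (bobSeq n g) z → (z : ℕ) = x := by
  have hmono : StrictMono (aliceSeq n f) := fun i j hij => by
    have := strictMono_nat_of_lt_succ (f := f) fun x => by linarith [hf.one_le x]
    exact Int.cast_lt.mpr (this hij)
  have hanti : StrictAnti (bobSeq n g) := fun i j hij => by
    have := strictMono_nat_of_lt_succ (f := g) fun x => by linarith [hg.one_le x]
    exact Int.cast_lt.mpr (neg_lt_neg (this hij))
  have hmem : (⟨x, by omega⟩ : Fin n) ∈ crossings (aliceSeq n f) (bobSeq n g) :=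
    ⟨Int.cast_le.mpr (by simp only; linarith), by simp only; omega,
      Int.cast_lt.mpr (by linarith)⟩
  have hconvex : ConvexSeq (aliceSeq n f) := fun i h => by
    have := hf.mono i
    simp only [aliceSeq]
    exact_mod_cast this
  have hconcave : ConcaveSeq (bobSeq n g) := fun i h => by
    have := hg.mono i
    simp only [bobSeq]
    have : -g (i + 2) - -g (i + 1) ≤ -g (i + 1) - -g i := by linarith
    exact_mod_cast this
  have hbits : ∀ {f : ℕ → ℤ}, SlopesIn (2 ^ e) f → |f N| ≤ 2 ^ e → ∀ i < n,
      (f i).natAbs < 2 ^ n ^ 3 := fun {f} hf hfN i hi => by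
    have h2 := hf.abs_le hN hi (by positivity) hfN
    have h3 : ((f i).natAbs : ℤ) ≤ ((n + 1) * 2 ^ e : ℕ) := by
      rw [Int.natCast_natAbs]; exact_mod_cast h2
    exact lt_of_le_of_lt (by exact_mod_cast h3) (add_one_mul_two_pow_lt hn he)
  have hone : 1 < 2 ^ n ^ 3 := Nat.one_lt_two_pow (by positivity)
  refine ⟨⟨⟨hmono, hconvex, hanti, hconcave, ⟨_, hmem⟩⟩, fun i => ?_⟩, fun z hz => ?_⟩
  · simp only [aliceSeq, bobSeq, Rat.num_intCast, Rat.den_intCast, Int.natAbs_neg]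
    exact ⟨hbits hf hfN i i.2, hone, hbits hg hgN i i.2, hone⟩
  · exact congrArg Fin.val (le_antisymm (hz.2 hmem) (crossings_le_of_mem hmono hanti hmem hz.1))

/-! ### From protocols to games -/

/-- The bit strings of length at most `C`. -/
abbrev ShortMsg (C : ℕ) : Type := (m : Fin (C + 1)) × List.Vector Bool m

instance (C : ℕ) : Nonempty (ShortMsg C) := ⟨⟨0, List.Vector.nil⟩⟩

theorem card_shortMsg_le (C : ℕ) : Fintype.card (ShortMsg C) ≤ 2 ^ (C + 1) := by
  rw [Fintype.card_sigma]
  simp only [card_vector, Fintype.card_bool]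
  rw [Fin.sum_univ_eq_sum_range (fun m => 2 ^ m)]
  exact (Nat.geomSum_lt le_rfl fun m hm => Finset.mem_range.mp hm).le

/-- The underlying bit string. -/
def ShortMsg.toList {C : ℕ} (m : ShortMsg C) : List Bool := m.2.toList

/-- The first `C` bits of a bit string. -/
def ShortMsg.truncate (C : ℕ) (l : List Bool) : ShortMsg C :=
  ⟨⟨(l.take C).length, by simp⟩, ⟨l.take C, rfl⟩⟩

theorem ShortMsg.toList_truncate {C : ℕ} {l : List Bool} (h : l.length ≤ C) :
    (ShortMsg.truncate C l).toList = l := List.take_of_length_le h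

namespace DetProtocol

variable {X Y Z : Type}

/-- Alice's part of a protocol, with messages cut off after `C` bits. Her answer is a dummy, because
only Bob is ever asked for one. -/
def alicePlayer (π : DetProtocol X Y Z) (C : ℕ) : Player X (ShortMsg C) where
  msg x h := ShortMsg.truncate C (π.aliceMsg x (h.map ShortMsg.toList))
  out _ _ := false

/-- Bob's part of a protocol, with messages cut off after `C` bits; his output is decoded to a
bit. -/
def bobPlayer (π : DetProtocol X Y Z) (C : ℕ) (decode : Z → Bool) : Player Y (ShortMsg C) where
  msg y h := ShortMsg.truncate C (π.bobMsg y (h.map ShortMsg.toList))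
  out y h := decode (π.output y (h.map ShortMsg.toList))

theorem length_le_cost (π : DetProtocol X Y Z) (r : ℕ) (x : X) (y : Y) {t : ℕ} (ht : t ≤ r)
    {l : List Bool} (hl : l ∈ π.transcript r x y t) : l.length ≤ π.cost r x y := by
  have mono : ∀ d, l ∈ π.transcript r x y (t + d) := by
    intro d
    induction d with
    | zero => exact hl
    | succ d ih => exact List.mem_append_left _ ih
  have hr := mono (r - t)
  rw [Nat.add_sub_cancel' ht] at hr
  exact List.le_sum_of_mem (List.mem_map_of_mem hr)

/-- A run of the protocol whose cost is at most `C` is a run of the two players. -/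
theorem play_eq_decode_result (π : DetProtocol X Y Z) {r C : ℕ} {x : X} {y : Y}
    (hC : π.cost r x y ≤ C) (decode : Z → Bool) {j : ℕ} (hj : j ≤ r) :
    (if Odd j then
      play j (π.alicePlayer C) (π.bobPlayer C decode) x y
        ((π.transcript r x y (r - j)).map (ShortMsg.truncate C))
    else
      play j (π.bobPlayer C decode) (π.alicePlayer C) y x
        ((π.transcript r x y (r - j)).map (ShortMsg.truncate C)))
      = decode (π.result r x y) := by
  have hist : ∀ t ≤ r, ((π.transcript r x y t).map (ShortMsg.truncate C)).map ShortMsg.toList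
      = π.transcript r x y t := by
    intro t ht
    rw [List.map_map]
    refine (List.map_congr_left fun l hl => ?_).trans (List.map_id _)
    exact ShortMsg.toList_truncate ((π.length_le_cost r x y ht hl).trans hC)
  induction j with
  | zero => simp [play, bobPlayer, hist, result]
  | succ j ih =>
    have hprev := ih (by omega)
    have hpar : Odd (r + (r - (j + 1))) ↔ Odd (j + 1) := by
      obtain ⟨d, rfl⟩ := Nat.exists_eq_add_of_le hj
      rw [Nat.add_sub_cancel_left]
      grind
    rw [show r - j = r - (j + 1) + 1 by omega, transcript] at hprev
    simp only [hpar, List.map_append, List.map_cons, List.map_nil] at hprev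
    rw [← hprev]
    by_cases h : Odd (j + 1)
    · have h' : ¬ Odd j := by grind
      simp only [h, h', if_true, if_false, play, alicePlayer, hist _ (Nat.sub_le r (j + 1))]
    · have h' : Odd j := by grind
      simp only [h, h', if_true, if_false, play, bobPlayer, hist _ (Nat.sub_le r (j + 1))]

end DetProtocol

/-- The averaging argument: if no outcome of the random string makes the protocol correct on more
than a fraction `β` of a finite family of valid inputs, then `β ≥ 2 / 3`. -/
theorem two_thirds_le_of_sum_le {X Y Z Ω ι : Type} [MeasurableSpace Ω] {μ : Measure Ω}
    [IsProbabilityMeasure μ] {π : Ω → DetProtocol X Y Z} {r : ℕ} {P : CommProblem X Y Z}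
    (hsolves : SolvesInRounds μ π r P) [Fintype ι] [Nonempty ι] (x : ι → X) (y : ι → Y)
    (hvalid : ∀ i, P.valid (x i) (y i)) (good : Ω → ι → Prop) [∀ ω i, Decidable (good ω i)]
    (hgood : ∀ ω i, P.correct (x i) (y i) ((π ω).result r (x i) (y i)) → good ω i)
    {β : ℝ} (h : ∀ ω, ∑ i, (if good ω i then (1 : ℝ) else 0) ≤ β * Fintype.card ι) :
    2 / 3 ≤ β := by
  classical
  let E : ι → Set Ω := fun i => {ω | P.correct (x i) (y i) ((π ω).result r (x i) (y i))}
  have hE : ∀ i, MeasurableSet (E i) := fun i => (hsolves _ _ (hvalid i)).1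
  have hcard : (0 : ℝ) < Fintype.card ι := by exact_mod_cast Fintype.card_pos
  have hpoint : ∀ ω, ∑ i, (E i).indicator (1 : Ω → ℝ≥0∞) ω
      ≤ ENNReal.ofReal (β * Fintype.card ι) := by
    intro ω
    calc ∑ i, (E i).indicator (1 : Ω → ℝ≥0∞) ω
        ≤ ∑ i, ENNReal.ofReal (if good ω i then 1 else 0) := by
          refine Finset.sum_le_sum fun i _ => ?_
          by_cases hi : ω ∈ E i
          · simp [hi, hgood ω i hi]
          · simp [hi]
      _ = ENNReal.ofReal (∑ i, if good ω i then 1 else 0) :=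
          (ENNReal.ofReal_sum_of_nonneg fun i _ => by split_ifs <;> norm_num).symm
      _ ≤ _ := ENNReal.ofReal_le_ofReal (h ω)
  have hsum : ENNReal.ofReal (2 / 3 * Fintype.card ι) ≤ ENNReal.ofReal (β * Fintype.card ι) := by
    calc ENNReal.ofReal (2 / 3 * Fintype.card ι) = ∑ _i : ι, (2 / 3 : ℝ≥0∞) := by
          rw [Finset.sum_const, Finset.card_univ, nsmul_eq_mul, mul_comm,
            ENNReal.ofReal_mul hcard.le, ENNReal.ofReal_natCast,
            ENNReal.ofReal_div_of_pos (by norm_num)]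
          simp
      _ ≤ ∑ i, μ (E i) := Finset.sum_le_sum fun i _ => (hsolves _ _ (hvalid i)).2
      _ = ∫⁻ ω, ∑ i, (E i).indicator (1 : Ω → ℝ≥0∞) ω ∂μ := by
          rw [lintegral_finsetSum _ fun i _ => measurable_one.indicator (hE i)]
          exact Finset.sum_congr rfl fun i _ => (lintegral_indicator_one (hE i)).symm
      _ ≤ ∫⁻ _ω, ENNReal.ofReal (β * Fintype.card ι) ∂μ := lintegral_mono hpoint
      _ = _ := by simp
  rcases le_or_gt 0 β with hβ | hβ
  · rw [ENNReal.ofReal_le_ofReal_iff (by positivity)] at hsum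
    exact le_of_mul_le_mul_right hsum hcard
  · have h1 : ENNReal.ofReal (β * Fintype.card ι) = 0 :=
      ENNReal.ofReal_of_nonpos (mul_nonpos_of_nonpos_of_nonneg hβ.le hcard.le)
    rw [h1, nonpos_iff_eq_zero, ENNReal.ofReal_eq_zero] at hsum
    nlinarith

/-! ### The lower bound -/

section LowerBound

variable {n r C : ℕ} {Ω : Type} [MeasurableSpace Ω] {μ : Measure Ω} [IsProbabilityMeasure μ]
  {π : Ω → DetProtocol (Fin n → ℚ) (Fin n → ℚ) (Fin n)}

/-- Without communication, Bob cannot distinguish two inputs of Alice that need different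
answers. -/
theorem one_le_of_solves (hn : 3 ≤ n) (hsolves : SolvesInRounds μ π r (TCIBits n (n ^ 3)))
    (hcost : ∀ ω x y, (TCIBits n (n ^ 3)).valid x y → (π ω).cost r x y ≤ C) : 1 ≤ C := by
  by_contra! hC
  obtain ⟨ρ⟩ := realization_guess (R := 2 ^ 2) (by norm_num)
  have hinst : ∀ b : Bool, ∃ x, ρ.decode x = b ∧ _ := fun b =>
    let ⟨x, hx, h0, h1, hb⟩ := ρ.cross b
    ⟨x, hb, valid_of_slopesIn (f := ρ.v b) (g := ρ.u ()) hn (by omega) (by nlinarith)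
      (ρ.slopes_v b) (ρ.slopes_u ()) ((congrArg abs (ρ.v_end b)).trans_le (by norm_num))
      (ρ.u_end ()) hx (by rw [add_comm]; exact h0) (by rw [add_comm]; exact h1)⟩
  have hempty : ∀ ω (b : Bool), (π ω).transcript r (aliceSeq n (ρ.v b)) (bobSeq n (ρ.u ())) r
      = List.replicate r [] := by
    intro ω b
    obtain ⟨x, -, hv, -⟩ := hinst b
    refine List.eq_replicate_iff.mpr ⟨?_, fun l hl => ?_⟩
    · have : ∀ t, ((π ω).transcript r (aliceSeq n (ρ.v b)) (bobSeq n (ρ.u ())) t).length = t := by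
        intro t
        induction t with
        | zero => rfl
        | succ t ih => simp [DetProtocol.transcript, ih]
      exact this r
    · have h1 := (π ω).length_le_cost r _ _ le_rfl hl
      have h2 := hcost ω _ _ hv
      exact List.length_eq_zero_iff.mp (by omega)
  have key := two_thirds_le_of_sum_le hsolves (ι := Bool) (fun b => aliceSeq n (ρ.v b))
    (fun _ => bobSeq n (ρ.u ())) (fun b => (hinst b).choose_spec.2.1)
    (fun ω b => ρ.decode ((π ω).output (bobSeq n (ρ.u ())) (List.replicate r [])) = b)
    (fun ω b hb => by
      obtain ⟨x, hx, -, hcor⟩ := hinst b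
      have h2 := hcor _ hb
      rw [DetProtocol.result, hempty] at h2
      rw [h2, hx])
    (β := 1 / 2) (fun ω => by
      cases ρ.decode ((π ω).output (bobSeq n (ρ.u ())) (List.replicate r [])) <;> simp)
  norm_num at key

/-- The bound from round elimination for the game with `k` entries per level. -/
theorem le_mul_cost_of_solves {k : ℕ} (hk : 2 ≤ k) (hr : 1 ≤ r) (hn : 3 ≤ n)
    (hkn : 3 * k ^ r ≤ n) (hbits : (k + 2) ^ r * (k + 4) ≤ n * n)
    (hsolves : SolvesInRounds μ π r (TCIBits n (n ^ 3)))
    (hcost : ∀ ω x y, (TCIBits n (n ^ 3)).valid x y → (π ω).cost r x y ≤ C) :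
    (k : ℝ) ≤ 72 * r ^ 2 * (C + 1) := by
  have : NeZero k := ⟨by omega⟩
  obtain ⟨ρ⟩ := realization_nestedGame k r
  have hN : curveLength k r < n := by have := curveLength_add_one_le hk r; omega
  set G := nestedGame k r with hG
  have hr0 : (0 : ℝ) < r := by exact_mod_cast hr
  have hk0 : (0 : ℝ) < k := by exact_mod_cast (by omega : 0 < k)
  set c : ℝ := 1 / (6 * r) with hc
  have hc0 : 0 < c := by positivity
  let decode : Fin n → Bool := fun z => ρ.decode z
  have hv_end : ∀ t, |ρ.v t (curveLength k r)| ≤ 2 ^ ((k + 2) ^ r * (k + 4)) := fun t => by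
    rw [ρ.v_end]; positivity
  have key : 2 / 3 ≤ 1 / 2 + r * (Real.log (Fintype.card (ShortMsg C)) / (c * k) + c / 2) := by
    -- Alice sends the last message, so the parity of `r` decides who speaks first.
    by_cases hodd : Odd r
    · have hinst : ∀ ω, ∃ x, ρ.decode x = G.bit ω ∧ _ := fun ω =>
        let ⟨x, hx, h0, h1, hb⟩ := ρ.cross ω
        ⟨x, hb, valid_of_slopesIn (f := ρ.u (G.s ω)) (g := ρ.v (G.t ω)) hn hN hbits
          (ρ.slopes_u _) (ρ.slopes_v _) (ρ.u_end _) (hv_end _) hx h0 h1⟩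
      refine two_thirds_le_of_sum_le hsolves (ι := G.Seed) (fun ω => aliceSeq n (ρ.u (G.s ω)))
        (fun ω => bobSeq n (ρ.v (G.t ω))) (fun ω => (hinst ω).choose_spec.2.1)
        (fun τ ω => play r (((π τ).alicePlayer C).comap fun s => aliceSeq n (ρ.u s))
          (((π τ).bobPlayer C decode).comap fun t => bobSeq n (ρ.v t)) (G.s ω) (G.t ω) []
            = G.bit ω)
        (fun τ ω hω => ?_) (fun τ => score_nestedGame_le k hc0 r _ _ [])
      obtain ⟨x, hx, hval, hcor⟩ := hinst ω
      have h1 := (π τ).play_eq_decode_result (hcost τ _ _ hval) decode le_rfl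
      rw [if_pos hodd, Nat.sub_self] at h1
      rw [play_comap]
      refine h1.trans ?_
      change ρ.decode _ = _
      rw [hcor _ hω, hx]
    · have hinst : ∀ ω, ∃ x, ρ.decode x = G.bit ω ∧ _ := fun ω =>
        let ⟨x, hx, h0, h1, hb⟩ := ρ.cross ω
        ⟨x, hb, valid_of_slopesIn (f := ρ.v (G.t ω)) (g := ρ.u (G.s ω)) hn hN hbits
          (ρ.slopes_v _) (ρ.slopes_u _) (hv_end _) (ρ.u_end _) hx
          (by rw [add_comm]; exact h0) (by rw [add_comm]; exact h1)⟩
      refine two_thirds_le_of_sum_le hsolves (ι := G.Seed) (fun ω => aliceSeq n (ρ.v (G.t ω)))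
        (fun ω => bobSeq n (ρ.u (G.s ω))) (fun ω => (hinst ω).choose_spec.2.1)
        (fun τ ω => play r (((π τ).bobPlayer C decode).comap fun s => bobSeq n (ρ.u s))
          (((π τ).alicePlayer C).comap fun t => aliceSeq n (ρ.v t)) (G.s ω) (G.t ω) []
            = G.bit ω)
        (fun τ ω hω => ?_) (fun τ => score_nestedGame_le k hc0 r _ _ [])
      obtain ⟨x, hx, hval, hcor⟩ := hinst ω
      have h1 := (π τ).play_eq_decode_result (hcost τ _ _ hval) decode le_rfl
      rw [if_neg hodd, Nat.sub_self] at h1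
      rw [play_comap]
      refine h1.trans ?_
      change ρ.decode _ = _
      rw [hcor _ hω, hx]
  have hlog : Real.log (Fintype.card (ShortMsg C)) ≤ C + 1 := by
    have h1 : (Fintype.card (ShortMsg C) : ℝ) ≤ 2 ^ (C + 1) := by
      exact_mod_cast card_shortMsg_le C
    have h2 : (0 : ℝ) < Fintype.card (ShortMsg C) := by exact_mod_cast Fintype.card_pos
    have h3 : Real.log 2 ≤ 1 := by linarith [Real.log_two_lt_d9]
    calc Real.log (Fintype.card (ShortMsg C)) ≤ Real.log (2 ^ (C + 1)) := Real.log_le_log h2 h1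
      _ = (C + 1) * Real.log 2 := by rw [Real.log_pow]; push_cast; ring
      _ ≤ (C + 1) * 1 := by gcongr
      _ = C + 1 := mul_one _
  have h1 : r * (Real.log (Fintype.card (ShortMsg C)) / (c * k) + c / 2)
      = 6 * r ^ 2 * Real.log (Fintype.card (ShortMsg C)) / k + 1 / 12 := by
    rw [hc]; field_simp; ring
  rw [h1] at key
  have h2 : 1 / 12 ≤ 6 * r ^ 2 * Real.log (Fintype.card (ShortMsg C)) / k := by linarith
  rw [le_div_iff₀ hk0] at h2
  have h3 : 6 * (r : ℝ) ^ 2 * Real.log (Fintype.card (ShortMsg C)) ≤ 6 * r ^ 2 * (C + 1) := by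
    gcongr
  linarith

theorem rpow_div_sq_le_cost (hr : 1 ≤ r) (hn : 3 ≤ n)
    (hsolves : SolvesInRounds μ π r (TCIBits n (n ^ 3)))
    (hcost : ∀ ω x y, (TCIBits n (n ^ 3)).valid x y → (π ω).cost r x y ≤ C) :
    1 / 864 * (n : ℝ) ^ (1 / (r : ℝ)) / (r : ℝ) ^ 2 ≤ C := by
  have hC : (1 : ℝ) ≤ C := by exact_mod_cast one_le_of_solves hn hsolves hcost
  set z : ℝ := (n : ℝ) ^ (1 / (r : ℝ)) with hz
  have hr1 : (1 : ℝ) ≤ r := by exact_mod_cast hr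
  have hn1 : (1 : ℝ) ≤ n := by exact_mod_cast (by omega : 1 ≤ n)
  have hz0 : 0 ≤ z := by positivity
  have hzr : z ^ r = n := by
    rw [hz, one_div]
    exact Real.rpow_inv_natCast_pow (by linarith) (by omega)
  have hzn : z ≤ n := by
    rw [hz]
    calc (n : ℝ) ^ (1 / (r : ℝ)) ≤ (n : ℝ) ^ (1 : ℝ) :=
          Real.rpow_le_rpow_of_exponent_le hn1 ((div_le_one (by linarith)).mpr hr1)
      _ = n := Real.rpow_one _
  have hr2 : (1 : ℝ) ≤ (r : ℝ) ^ 2 := one_le_pow₀ hr1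
  rw [div_le_iff₀ (by linarith)]
  -- For small `n` it is enough that at least one bit is needed.
  rcases le_or_gt z 6 with hsmall | hlarge
  · nlinarith
  · set k := ⌊z / 3⌋₊ with hk
    have hk1 : (k : ℝ) ≤ z / 3 := Nat.floor_le (by positivity)
    have hk2 : z / 3 < k + 1 := Nat.lt_floor_add_one _
    have hk3 : 2 ≤ k := Nat.le_floor (by push_cast; linarith)
    have hk4 : (2 : ℝ) ≤ k := by exact_mod_cast hk3
    have hkn : 3 * k ^ r ≤ n := by
      have h1 : (3 * k : ℝ) ^ r ≤ z ^ r := pow_le_pow_left₀ (by positivity) (by linarith) r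
      rw [hzr] at h1
      have h2 : (3 * k) ^ r ≤ n := by exact_mod_cast h1
      calc 3 * k ^ r ≤ 3 ^ r * k ^ r := by gcongr; exact Nat.le_self_pow (by omega) 3
        _ = (3 * k) ^ r := (mul_pow ..).symm
        _ ≤ n := h2
    have hbits : (k + 2) ^ r * (k + 4) ≤ n * n := by
      have h1 : (k + 2 : ℝ) ^ r ≤ z ^ r := pow_le_pow_left₀ (by positivity) (by linarith) r
      rw [hzr] at h1
      refine Nat.mul_le_mul (by exact_mod_cast h1) ?_
      have h2 : (k + 4 : ℝ) ≤ n := by linarith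
      exact_mod_cast h2
    have key := le_mul_cost_of_solves hk3 hr hn hkn hbits hsolves hcost
    have h1 : (r : ℝ) ^ 2 * (C + 1) ≤ r ^ 2 * (2 * C) := by gcongr; linarith
    linarith

end LowerBound

theorem roundCC_TCIBits_le (r n s : ℕ) : roundCC r (TCIBits n s) ≤ roundCC r (TCI n) := by
  refine sInf_le_sInf ?_
  rintro k ⟨Ω, hΩ, μ, π, hμ, hsolves, hcost⟩
  exact ⟨Ω, hΩ, μ, π, hμ, fun x y h => hsolves x y h.1, fun ω x y h => hcost ω x y h.1⟩

theorem mainTheorem1 :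
    ∃ c : ℝ, 0 < c ∧ ∃ K : ℕ, ∀ r n : ℕ, 1 ≤ r → 3 ≤ n →
      ENNReal.ofReal (c * (n : ℝ) ^ (1 / (r : ℝ)) / (r : ℝ) ^ 2) ≤ (roundCC r (TCI n) : ℝ≥0∞) ∧
      ENNReal.ofReal (c * (n : ℝ) ^ (1 / (r : ℝ)) / (r : ℝ) ^ 2) ≤
        (roundCC r (TCIBits n (n ^ K)) : ℝ≥0∞) := by
  refine ⟨1 / 864, by norm_num, 3, fun r n hr hn => ?_⟩
  set y : ℝ := 1 / 864 * (n : ℝ) ^ (1 / (r : ℝ)) / (r : ℝ) ^ 2 with hy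
  have hbits : ((⌈y⌉₊ : ℕ) : ℕ∞) ≤ roundCC r (TCIBits n (n ^ 3)) := by
    refine le_sInf ?_
    rintro κ ⟨Ω, hΩ, μ, π, hμ, hsolves, hcost⟩
    cases κ with
    | top => exact le_top
    | coe C =>
      have := rpow_div_sq_le_cost hr hn hsolves
        fun ω x y h => by exact_mod_cast hcost ω x y h
      exact Nat.cast_le.mpr (Nat.ceil_le.mpr this)
  have hle : ENNReal.ofReal y ≤ ((⌈y⌉₊ : ℕ∞) : ℝ≥0∞) := by
    rw [ENat.toENNReal_coe, ← ENNReal.ofReal_natCast]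
    exact ENNReal.ofReal_le_ofReal (Nat.le_ceil y)
  have h := hle.trans (ENat.toENNReal_le.mpr hbits)
  exact ⟨h.trans (ENat.toENNReal_le.mpr (roundCC_TCIBits_le r n _)), h⟩
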